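/- Let $n\in\mathbb N$, let $B$ be a real $n\times n$ matrix all of whose (complex) eigenvalues have modulus greater than $1$, and let $\mathcal D\subset\mathbb R^n$ be a finite set with $0\in\mathcal D$ and $\operatorname{card}(\mathcal D)=|\det B|$. Let $K=K(B,\mathcal D)$ be the unique non-empty compact subset of $\mathbb R^n$ satisfying $K=\bigcup_{d\in\mathcal D}B^{-1}(K+d)$, and assume that $K$ is a self-affine tile, i.e. that its Lebesgue measure $|K|$ is positive. Put $$\mathcal D_\infty=\bigcup_{s\ge 1}\Big\{\sum_{j=0}^{s-1}B^j\ell_j:\ \ell_0,\dots,\ell_{s-1}\in\mathcal D\Big\}.$$ For $\Lambda\subset\mathbb R^n$, the upper and lower Beurling densities of $\Lambda$ are $$D^+(\Lambda)=\limsup_{N\to\infty}\sup_{z\in\mathbb R^n}\frac{\operatorname{card}(\Lambda\cap I_N(z))}{N^n},\qquad D^-(\Lambda)=\liminf_{N\to\infty}\inf_{z\in\mathbb R^n}\frac{\operatorname{card}(\Lambda\cap I_N(z))}{N^n},$$ where $I_N(z)=\{y\in\mathbb R^n: |y_i-z_i|\le N/2,\ i=1,\dots,n\}$. Then: (a) $K$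 contains a neighborhood of $0$ if and only if $D^+(\mathcal D_\infty)=D^-(\mathcal D_\infty)=\frac1{|K|}$. (b) $K$ does not contain a neighborhood of $0$ if and only if $D^+(\mathcal D_\infty)=\frac1{|K|}$ and $D^-(\mathcal D_\infty)=0$. -/

import Mathlib

open MeasureTheory Filter Topology Matrix

namespace SelfAffine

/-- A real square matrix is expanding if all its (complex) eigenvalues have modulus `> 1`. -/
def IsExpanding {n : ℕ} (B : Matrix (Fin n) (Fin n) ℝ) : Prop :=
  ∀ z : ℂ, Module.End.HasEigenvalue (Matrix.toLin' (B.map (fun t : ℝ => (t : ℂ)))) z → 1 < ‖z‖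

/-- A self-affine pair `(B, D)`: an expanding real matrix together with a finite set of digits
containing `0`. -/
structure IsSelfAffinePair {n : ℕ} (B : Matrix (Fin n) (Fin n) ℝ)
    (D : Finset (Fin n → ℝ)) : Prop where
  expanding : IsExpanding B
  zero_mem : (0 : Fin n → ℝ) ∈ D

/-- The map `f_d (x) = B⁻¹ (x + d)` of the iterated function system. -/
noncomputable def ifsMap {n : ℕ} (B : Matrix (Fin n) (Fin n) ℝ) (d : Fin n → ℝ) :
    (Fin n → ℝ) → (Fin n → ℝ) :=
  fun x => B⁻¹ *ᵥ (x + d)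

/-- `K` is the self-affine set `K(B, D)`: the (unique) non-empty compact set which is the union of
its images under the maps `f_d`, `d ∈ D`. -/
structure IsSelfAffineSet {n : ℕ} (B : Matrix (Fin n) (Fin n) ℝ)
    (D : Finset (Fin n → ℝ)) (K : Set (Fin n → ℝ)) : Prop where
  nonempty : K.Nonempty
  isCompact : IsCompact K
  eq_iUnion : K = ⋃ d ∈ D, ifsMap B d '' K

/-- `K` is the self-affine tile `K(B, D)`: `(B, D)` is a self-affine pair with
`card D = |det B|`, and its self-affine set `K` has positive Lebesgue measure. -/
structure IsSelfAffineTile {n : ℕ} (B : Matrix (Fin n) (Fin n) ℝ)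
    (D : Finset (Fin n → ℝ)) (K : Set (Fin n → ℝ)) : Prop where
  pair : IsSelfAffinePair B D
  card_eq : (D.card : ℝ) = |B.det|
  selfAffineSet : IsSelfAffineSet B D K
  volume_pos : 0 < volume K

/-- The set `D_s` of all sums `ℓ₀ + B ℓ₁ + ⋯ + B^(s-1) ℓ_(s-1)` with all `ℓ_j ∈ D`. -/
def digitExpansions {n : ℕ} (B : Matrix (Fin n) (Fin n) ℝ) (D : Finset (Fin n → ℝ)) (s : ℕ) :
    Set (Fin n → ℝ) :=
  {x | ∃ l : Fin s → (Fin n → ℝ), (∀ j, l j ∈ D) ∧ x = ∑ j : Fin s, (B ^ (j : ℕ)) *ᵥ l j}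

/-- The set `D_∞`, the union of the sets `D_s` over all `s ≥ 1`. -/
def digitInfty {n : ℕ} (B : Matrix (Fin n) (Fin n) ℝ) (D : Finset (Fin n → ℝ)) :
    Set (Fin n → ℝ) :=
  ⋃ (s : ℕ) (_ : 1 ≤ s), digitExpansions B D s

/-- The closed cube `I_N(z)` with centre `z` and side length `N`. -/
def cube {n : ℕ} (N : ℝ) (z : Fin n → ℝ) : Set (Fin n → ℝ) :=
  {y | ∀ i, |y i - z i| ≤ N / 2}

/-- The upper Beurling density of a positive Borel measure on `ℝⁿ`. -/
noncomputable def upperBeurlingDensity {n : ℕ} (μ : Measure (Fin n → ℝ)) : ENNReal :=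
  limsup (fun N : ℝ => ⨆ z : Fin n → ℝ, μ (cube N z) / ENNReal.ofReal N ^ n) atTop

/-- The lower Beurling density of a positive Borel measure on `ℝⁿ`. -/
noncomputable def lowerBeurlingDensity {n : ℕ} (μ : Measure (Fin n → ℝ)) : ENNReal :=
  liminf (fun N : ℝ => ⨅ z : Fin n → ℝ, μ (cube N z) / ENNReal.ofReal N ^ n) atTop

/-- The sum of the unit point masses at the points of `Λ`. -/
noncomputable def pointMasses {n : ℕ} (Λ : Set (Fin n → ℝ)) : Measure (Fin n → ℝ) :=
  Measure.sum (fun x : Λ => Measure.dirac (x : Fin n → ℝ))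

/-- The upper Beurling density of a subset of `ℝⁿ`. -/
noncomputable def upperDensity {n : ℕ} (Λ : Set (Fin n → ℝ)) : ENNReal :=
  upperBeurlingDensity (pointMasses Λ)

/-- The lower Beurling density of a subset of `ℝⁿ`. -/
noncomputable def lowerDensity {n : ℕ} (Λ : Set (Fin n → ℝ)) : ENNReal :=
  lowerBeurlingDensity (pointMasses Λ)

end SelfAffine

open scoped Pointwise

namespace SelfAffine

variable {n : ℕ} {B : Matrix (Fin n) (Fin n) ℝ} {D : Finset (Fin n → ℝ)} {K : Set (Fin n → ℝ)}

/-! ### Contraction by inverse powers of `B` -/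

section Contraction
open scoped Matrix.Norms.Operator

/-! Write `D_s` for the digit sums of length `s`. Iterating the set equation gives `B^s K = D_s +
K`, and the `D_s` increase because `0 ∈ D`. The left side has volume `(card D)^s |K|` while `D_s`
has at most `(card D)^s` points, so the translates `d + K`, `d ∈ D_∞`, cannot overlap in measure
(`card_mul_volume_le`).

Packing bounds the number of points in any cube of side `N` by `(N + 2r)^n / |K|`, where `K` lies in
the ball of radius `r`. Averaging over the large sets `B^s K`, which are fully covered, produces
cubes that nearly reach this bound (`le_mul_volume`). Hence `D⁺ = 1/|K|` always, and only `D⁻`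
distinguishes the two cases.

If `K` is a neighborhood of `0`, the sets `B^s K` exhaust space, so `D_∞ + K` covers everything and
every cube has nearly the full count. Conversely, if `D_∞` meets every ball of some fixed radius,
rescaling by `B⁻ˢ` forces `K` to be a neighborhood of `0` (`mem_nhds_zero_of_relativelyDense`).
Otherwise there are empty cubes of every size and `D⁻ = 0`. Both equivalences follow since `1/|K| ≠
0`. -/

theorem tendsto_norm_pow_of_spectralRadius_lt_one {A : Type*} [NormedRing A] [NormedAlgebra ℂ A]
    [CompleteSpace A] {a : A} (ha : spectralRadius ℂ a < 1) :
    Tendsto (fun s : ℕ => ‖a ^ s‖) atTop (𝓝 0) := by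
  obtain ⟨r, hr, hr1⟩ := ENNReal.lt_iff_exists_nnreal_btwn.1 ha
  have hr1' : r < 1 := by exact_mod_cast hr1
  have h := spectrum.pow_nnnorm_pow_one_div_tendsto_nhds_spectralRadius a
  have hle : ∀ᶠ s : ℕ in atTop, ‖a ^ s‖ ≤ (r : ℝ) ^ s := by
    filter_upwards [h.eventually_lt_const hr, eventually_gt_atTop 0] with s hs hs0
    have h2 := (ENNReal.rpow_le_rpow_iff (z := (s : ℝ)) (by positivity)).2 hs.le
    rw [← ENNReal.rpow_mul, one_div_mul_cancel (by positivity), ENNReal.rpow_one,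
      ENNReal.rpow_natCast] at h2
    exact_mod_cast h2
  exact squeeze_zero' (Eventually.of_forall fun _ => norm_nonneg _) hle
    (tendsto_pow_atTop_nhds_zero_of_lt_one r.2 (by exact_mod_cast hr1'))

/-- Eigenvalues of the complexified inverse are reciprocals of those of `B`, so its spectral radius
is below 1; complexification preserves the operator norm. -/
theorem IsExpanding.tendsto_norm_inv_pow (hB : IsExpanding B) (hdet : B.det ≠ 0) :
    Tendsto (fun s : ℕ => ‖B⁻¹ ^ s‖) atTop (𝓝 0) := by
  let φ : Matrix (Fin n) (Fin n) ℝ →+* Matrix (Fin n) (Fin n) ℂ :=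
    (algebraMap ℝ ℂ).mapMatrix
  have hφ : ∀ M, ‖φ M‖ = ‖M‖ := fun M => by
    simp only [linfty_opNorm_def]
    congr 2
    ext i
    simp [φ]
  have hinv : φ B * φ B⁻¹ = 1 := by
    rw [← map_mul, Matrix.mul_nonsing_inv _ (isUnit_iff_ne_zero.2 hdet), map_one]
  have hinv' : φ B⁻¹ * φ B = 1 := by
    rw [← map_mul, Matrix.nonsing_inv_mul _ (isUnit_iff_ne_zero.2 hdet), map_one]
  let u : (Matrix (Fin n) (Fin n) ℂ)ˣ := ⟨φ B, φ B⁻¹, hinv, hinv'⟩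
  have hspec : ∀ k ∈ spectrum ℂ (φ B⁻¹), ‖k‖₊ < 1 := fun k hk => by
    have hk0 : k ≠ 0 := fun h0 => by
      have := spectrum.ne_zero_of_mem_of_unit (a := u⁻¹) (r := k) hk
      exact this h0
    have h1 : k⁻¹ ∈ spectrum ℂ (φ B) := by
      have := (spectrum.inv_mem_iff (r := Units.mk0 k hk0) (a := u⁻¹)).1 hk
      simpa [u] using this
    have h2 : Module.End.HasEigenvalue (Matrix.toLin' (φ B)) k⁻¹ := by
      rw [Module.End.hasEigenvalue_iff_mem_spectrum, Matrix.spectrum_toLin']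
      exact h1
    have h3 := hB _ h2
    rw [norm_inv] at h3
    have : ‖k‖ < 1 := by
      by_contra hc
      exact absurd (inv_le_one_of_one_le₀ (not_lt.1 hc)) (not_le.2 h3)
    exact_mod_cast this
  have hrad : spectralRadius ℂ (φ B⁻¹) < 1 := by
    -- The spectrum is empty only for `n = 0`.
    rcases (spectrum ℂ (φ B⁻¹)).eq_empty_or_nonempty with he | hne
    · simp [spectralRadius, he]
    · exact_mod_cast spectrum.spectralRadius_lt_of_forall_lt_of_nonempty hne hspec
  have := tendsto_norm_pow_of_spectralRadius_lt_one hrad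
  simpa only [← map_pow, hφ] using this

/-- The inverse powers of an expanding matrix shrink bounded sets uniformly to `0`. -/
theorem IsExpanding.eventually_norm_le (hB : IsExpanding B) (hdet : B.det ≠ 0) (R : ℝ) {ε : ℝ}
    (hε : 0 < ε) : ∀ᶠ s : ℕ in atTop, ∀ x : Fin n → ℝ, ‖x‖ ≤ R → ‖(B⁻¹ ^ s) *ᵥ x‖ ≤ ε := by
  have h := (hB.tendsto_norm_inv_pow hdet).mul_const |R|
  rw [zero_mul] at h
  filter_upwards [h.eventually_lt_const hε] with s hs x hx
  calc ‖(B⁻¹ ^ s) *ᵥ x‖ ≤ ‖B⁻¹ ^ s‖ * ‖x‖ := linfty_opNorm_mulVec _ _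
    _ ≤ ‖B⁻¹ ^ s‖ * |R| := by gcongr; exact hx.trans (le_abs_self R)
    _ ≤ ε := hs.le

end Contraction

/-! ### Digit expansions and the iterated set equation -/

theorem digitExpansions_one : digitExpansions B D 1 = D := by
  ext x
  simp only [digitExpansions, Set.mem_ofPred_eq, Finset.mem_coe, Fin.sum_univ_one]
  constructor
  · rintro ⟨l, hl, rfl⟩
    simpa using hl 0
  · exact fun hx => ⟨fun _ => x, fun _ => hx, by simp⟩

theorem digitExpansions_zero : digitExpansions B D 0 = {0} := by
  ext x
  simp [digitExpansions]

theorem digitExpansions_add (s t : ℕ) :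
    digitExpansions B D (s + t) =
      digitExpansions B D s + (B ^ s).mulVec '' digitExpansions B D t := by
  ext x
  simp only [Set.mem_add, Set.mem_image]
  constructor
  · rintro ⟨l, hl, rfl⟩
    refine ⟨_, ⟨fun j => l (j.castAdd t), fun j => hl _, rfl⟩, _,
      ⟨_, ⟨fun j => l (j.natAdd s), fun j => hl _, rfl⟩, rfl⟩, ?_⟩
    simp [Fin.sum_univ_add, Matrix.mulVec_sum, pow_add, Matrix.mulVec_mulVec]
  · rintro ⟨_, ⟨l, hl, rfl⟩, _, ⟨_, ⟨l', hl', rfl⟩, rfl⟩, rfl⟩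
    refine ⟨Fin.append l l', fun j => ?_, ?_⟩
    · refine Fin.addCases (fun i => ?_) (fun i => ?_) j
      · simpa using hl i
      · simpa using hl' i
    · simp [Fin.sum_univ_add, Matrix.mulVec_sum, pow_add, Matrix.mulVec_mulVec]

theorem zero_mem_digitExpansions (h0 : (0 : Fin n → ℝ) ∈ D) (s : ℕ) :
    (0 : Fin n → ℝ) ∈ digitExpansions B D s :=
  ⟨fun _ => 0, fun _ => h0, by simp⟩

theorem digitExpansions_mono (h0 : (0 : Fin n → ℝ) ∈ D) : Monotone (digitExpansions B D) := by
  intro s t hst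
  obtain ⟨k, rfl⟩ := Nat.exists_eq_add_of_le hst
  rw [digitExpansions_add]
  exact fun x hx => ⟨x, hx, 0, ⟨0, zero_mem_digitExpansions h0 k, by simp⟩, by simp⟩

theorem mem_digitInfty (h0 : (0 : Fin n → ℝ) ∈ D) {x : Fin n → ℝ} :
    x ∈ digitInfty B D ↔ ∃ s, x ∈ digitExpansions B D s := by
  simp only [digitInfty, Set.mem_iUnion]
  constructor
  · rintro ⟨s, -, h⟩
    exact ⟨s, h⟩
  · rintro ⟨s, h⟩
    exact ⟨s + 1, by omega, digitExpansions_mono h0 (Nat.le_succ s) h⟩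

theorem exists_subset_digitExpansions (h0 : (0 : Fin n → ℝ) ∈ D) {F : Set (Fin n → ℝ)}
    (hF : F.Finite) (hsub : F ⊆ digitInfty B D) : ∃ s, F ⊆ digitExpansions B D s := by
  have h : ∀ᶠ s in atTop, ∀ x ∈ F, x ∈ digitExpansions B D s := by
    refine (eventually_all_finite hF).2 fun x hx => ?_
    obtain ⟨s, hs⟩ := (mem_digitInfty h0).1 (hsub hx)
    filter_upwards [eventually_ge_atTop s] with t ht using digitExpansions_mono h0 ht hs
  exact h.exists

theorem exists_finset_digitExpansions (s : ℕ) :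
    ∃ E : Finset (Fin n → ℝ), (E : Set (Fin n → ℝ)) = digitExpansions B D s ∧
      E.card ≤ D.card ^ s := by
  classical
  refine ⟨(Fintype.piFinset fun _ : Fin s => D).image
    fun l => ∑ j : Fin s, (B ^ (j : ℕ)) *ᵥ l j, ?_, ?_⟩
  · ext x
    simp [digitExpansions, eq_comm]
  · exact Finset.card_image_le.trans (by simp)

theorem IsSelfAffineSet.image_mulVec (hK : IsSelfAffineSet B D K) (hdet : B.det ≠ 0) :
    B.mulVec '' K = D + K := by
  have hu := isUnit_iff_ne_zero.2 hdet
  conv_lhs => rw [hK.eq_iUnion]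
  ext x
  simp only [Set.image_iUnion, Set.mem_iUnion, Set.mem_image, ifsMap, Set.mem_add,
    Finset.mem_coe, exists_prop]
  constructor
  · rintro ⟨d, hd, _, ⟨k, hk, rfl⟩, rfl⟩
    exact ⟨d, hd, k, hk, by simp [Matrix.mulVec_mulVec, Matrix.mul_nonsing_inv _ hu, add_comm]⟩
  · rintro ⟨d, hd, k, hk, rfl⟩
    exact ⟨d, hd, _, ⟨k, hk, rfl⟩,
      by simp [Matrix.mulVec_mulVec, Matrix.mul_nonsing_inv _ hu, add_comm]⟩

theorem image_mulVec_add (M : Matrix (Fin n) (Fin n) ℝ) (S T : Set (Fin n → ℝ)) :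
    M.mulVec '' (S + T) = M.mulVec '' S + M.mulVec '' T :=
  Set.image_add M.mulVecLin

theorem IsSelfAffineSet.image_pow_mulVec (hK : IsSelfAffineSet B D K) (hdet : B.det ≠ 0) (s : ℕ) :
    (B ^ s).mulVec '' K = digitExpansions B D s + K := by
  induction s with
  | zero => simp [digitExpansions_zero]
  | succ s ih =>
    have : (B ^ (s + 1)).mulVec = (B ^ s).mulVec ∘ B.mulVec := by
      ext1 x; simp [pow_succ, Matrix.mulVec_mulVec]
    rw [this, Set.image_comp, hK.image_mulVec hdet, image_mulVec_add, ih, digitExpansions_add,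
      digitExpansions_one, add_left_comm, add_assoc]

theorem volume_image_mulVec (M : Matrix (Fin n) (Fin n) ℝ) (S : Set (Fin n → ℝ)) :
    volume (M.mulVec '' S) = ENNReal.ofReal |M.det| * volume S := by
  have := Measure.addHaar_image_linearMap volume (Matrix.toLin' M) S
  rwa [LinearMap.det_toLin'] at this

/-! ### Non-overlapping translates -/

namespace IsSelfAffineTile

theorem det_ne_zero (hK : IsSelfAffineTile B D K) : B.det ≠ 0 := by
  intro h
  have := hK.card_eq
  rw [h, abs_zero, Nat.cast_eq_zero, Finset.card_eq_zero] at this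
  exact absurd hK.pair.zero_mem (by simp [this])

theorem volume_ne_top (hK : IsSelfAffineTile B D K) : volume K ≠ ⊤ :=
  hK.selfAffineSet.isCompact.measure_lt_top.ne

theorem volume_image_pow (hK : IsSelfAffineTile B D K) (s : ℕ) (S : Set (Fin n → ℝ)) :
    volume ((B ^ s).mulVec '' S) = (D.card : ENNReal) ^ s * volume S := by
  rw [volume_image_mulVec, Matrix.det_pow, abs_pow, ENNReal.ofReal_pow (abs_nonneg _),
    ← hK.card_eq, ENNReal.ofReal_natCast]

/-- Finitely many translates of a self-affine tile by elements of `D_∞` do not overlap. -/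
theorem card_mul_volume_le (hK : IsSelfAffineTile B D K) {F : Finset (Fin n → ℝ)}
    (hF : (F : Set (Fin n → ℝ)) ⊆ digitInfty B D) :
    F.card * volume K ≤ volume ((F : Set (Fin n → ℝ)) + K) := by
  classical
  obtain ⟨s, hs⟩ := exists_subset_digitExpansions hK.pair.zero_mem F.finite_toSet hF
  obtain ⟨E, hE, hcard⟩ := exists_finset_digitExpansions (B := B) (D := D) s
  have hFE : F ⊆ E := by rw [← Finset.coe_subset, hE]; exact hs
  have hbound : ∀ G : Finset (Fin n → ℝ),
      volume ((G : Set (Fin n → ℝ)) + K) ≤ G.card * volume K := fun G => by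
    rw [← Set.iUnion_add_left_image]
    refine (measure_biUnion_finset_le _ _).trans ?_
    simp
  -- Split `B^s K = E + K` into the parts from `F` and `E \ F`. Subadditivity on the second part
  -- leaves at least `card F · |K|` for the first.
  have h1 : (D.card : ENNReal) ^ s * volume K ≤
      volume ((F : Set (Fin n → ℝ)) + K) + (E \ F).card * volume K := by
    have hun : (E : Set (Fin n → ℝ)) =
        (F : Set (Fin n → ℝ)) ∪ ((E \ F : Finset _) : Set (Fin n → ℝ)) := by
      rw [← Finset.coe_union, Finset.union_sdiff_of_subset hFE]
    rw [← hK.volume_image_pow, hK.selfAffineSet.image_pow_mulVec hK.det_ne_zero, ← hE, hun,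
      Set.union_add]
    exact (measure_union_le _ _).trans (add_le_add_right (hbound _) _)
  have h2 : (F.card : ENNReal) * volume K + (E \ F).card * volume K ≤
      (D.card : ENNReal) ^ s * volume K := by
    rw [← add_mul, ← Nat.cast_add, add_comm, Finset.card_sdiff_add_card_eq_card hFE]
    gcongr
    exact_mod_cast hcard
  exact (ENNReal.add_le_add_iff_right
    (ENNReal.mul_ne_top (ENNReal.natCast_ne_top _) hK.volume_ne_top)).1 (h2.trans h1)

end IsSelfAffineTile

/-! ### Counting points in cubes -/

theorem cube_eq_closedBall {N : ℝ} (hN : 0 ≤ N) (z : Fin n → ℝ) :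
    cube N z = Metric.closedBall z (N / 2) := by
  ext y
  rw [mem_closedBall_iff_norm, pi_norm_le_iff_of_nonneg (by positivity : 0 ≤ N / 2)]
  rfl

theorem volume_closedBall_half {N : ℝ} (hN : 0 ≤ N) (z : Fin n → ℝ) :
    volume (Metric.closedBall z (N / 2)) = ENNReal.ofReal N ^ n := by
  rw [Real.volume_pi_closedBall _ (by positivity), mul_div_cancel₀ _ two_ne_zero, Fintype.card_fin,
    ENNReal.ofReal_pow hN]

theorem pointMasses_apply (Λ : Set (Fin n → ℝ)) {S : Set (Fin n → ℝ)} (hS : MeasurableSet S) :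
    pointMasses Λ S = ((Λ ∩ S).encard : ENNReal) := by
  rw [pointMasses, Measure.sum_apply _ hS, ← ENNReal.tsum_set_one,
    tsum_subtype (Λ ∩ S) (fun _ => 1), tsum_subtype Λ (fun x => Measure.dirac x S)]
  congr 1
  ext x
  by_cases h1 : x ∈ Λ <;> by_cases h2 : x ∈ S <;> simp [h1, h2, Measure.dirac_apply' _ hS]

/-- Allows counting through finite subsets before local finiteness of `D_∞` is known. -/
theorem _root_.Set.encard_mul_le_of_forall_finset {α : Type*} {S : Set α} {c M : ENNReal}
    (h : ∀ F : Finset α, (F : Set α) ⊆ S → F.card * c ≤ M) : (S.encard : ENNReal) * c ≤ M := by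
  rw [← ENNReal.tsum_set_const, ENNReal.tsum_eq_iSup_sum]
  refine iSup_le fun F => ?_
  have := h (F.map (Function.Embedding.subtype _)) (by simp)
  simpa using this

theorem countable_digitInfty : (digitInfty B D).Countable := by
  refine Set.countable_iUnion fun s => Set.countable_iUnion fun _ => ?_
  obtain ⟨E, hE, -⟩ := exists_finset_digitExpansions (B := B) (D := D) s
  exact hE ▸ E.countable_toSet

/-- A set covered by `D_∞ + K` has volume at most `|K|` times the number of nearby points. -/
theorem volume_inter_le {r : ℝ} {Λ : Set (Fin n → ℝ)} (hΛ : Λ.Countable)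
    (hKr : K ⊆ Metric.closedBall 0 r) (ρ : ℝ) (z : Fin n → ℝ) :
    volume ((Λ + K) ∩ Metric.closedBall z ρ) ≤
      pointMasses Λ (Metric.closedBall z (ρ + r)) * volume K := by
  rw [pointMasses_apply _ Metric.isClosed_closedBall.measurableSet, ← ENNReal.tsum_set_const]
  have hc : (Λ ∩ Metric.closedBall z (ρ + r)).Countable := hΛ.mono Set.inter_subset_left
  have hsub : (Λ + K) ∩ Metric.closedBall z ρ ⊆
      ⋃ d ∈ Λ ∩ Metric.closedBall z (ρ + r), (d +ᵥ K) := by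
    rintro _ ⟨⟨d, hd, k, hk, rfl⟩, hz⟩
    refine Set.mem_biUnion ⟨hd, ?_⟩ ⟨k, hk, rfl⟩
    have h1 := hKr hk
    rw [mem_closedBall_iff_norm] at *
    calc ‖d - z‖ = ‖(d + k - z) - (k - 0)‖ := by congr 1; abel
      _ ≤ _ := (norm_sub_le _ _).trans (add_le_add hz h1)
  refine (measure_mono hsub).trans ((measure_biUnion_le _ hc _).trans ?_)
  simp

namespace IsSelfAffineTile

/-- Every cube contains at most the expected number of points of `D_∞`, up to a boundary term. -/
theorem pointMasses_mul_le (hK : IsSelfAffineTile B D K) {r : ℝ} (hr : 0 ≤ r)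
    (hKr : K ⊆ Metric.closedBall 0 r) {N : ℝ} (hN : 0 ≤ N) (z : Fin n → ℝ) :
    pointMasses (digitInfty B D) (Metric.closedBall z (N / 2)) * volume K ≤
      ENNReal.ofReal (N + 2 * r) ^ n := by
  rw [pointMasses_apply _ Metric.isClosed_closedBall.measurableSet]
  refine Set.encard_mul_le_of_forall_finset fun F hF => ?_
  refine (hK.card_mul_volume_le (hF.trans Set.inter_subset_left)).trans ?_
  rw [← volume_closedBall_half (by positivity) z]
  refine measure_mono ?_
  calc (F : Set (Fin n → ℝ)) + K ⊆ Metric.closedBall z (N / 2) + Metric.closedBall 0 r :=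
        Set.add_subset_add (hF.trans Set.inter_subset_right) hKr
    _ ⊆ Metric.closedBall z ((N + 2 * r) / 2) := by
        rw [closedBall_add_closedBall (by positivity) hr, add_zero, add_div,
          mul_div_cancel_left₀ _ two_ne_zero]

theorem finite_inter_closedBall (hK : IsSelfAffineTile B D K) (ρ : ℝ) :
    (digitInfty B D ∩ Metric.closedBall 0 ρ).Finite := by
  obtain ⟨r, hr, hKr⟩ := hK.selfAffineSet.isCompact.isBounded.subset_closedBall_lt 0 0
  have h := hK.pointMasses_mul_le hr.le hKr (N := 2 * |ρ|) (by positivity) 0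
  rw [mul_div_cancel_left₀ _ two_ne_zero,
    pointMasses_apply _ Metric.isClosed_closedBall.measurableSet] at h
  have h2 := (h.trans_lt (ENNReal.pow_lt_top ENNReal.ofReal_lt_top)).ne
  have h3 : ((digitInfty B D ∩ Metric.closedBall 0 |ρ|).encard : ENNReal) ≠ ⊤ := fun h => by
    rw [h, ENNReal.top_mul hK.volume_pos.ne'] at h2
    exact h2 rfl
  have h4 : (digitInfty B D ∩ Metric.closedBall 0 |ρ|).Finite := by
    rw [← Set.encard_ne_top_iff]
    exact fun h => h3 (by simp [h])
  exact h4.subset (Set.inter_subset_inter_right _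
    (Metric.closedBall_subset_closedBall (le_abs_self ρ)))

end IsSelfAffineTile

/-! ### Averaging over cube centres -/

theorem lintegral_volume_inter_closedBall {X : Set (Fin n → ℝ)} (hX : MeasurableSet X) {N : ℝ}
    (hN : 0 ≤ N) :
    ∫⁻ z, volume (X ∩ Metric.closedBall z (N / 2)) = ENNReal.ofReal N ^ n * volume X := by
  let S : Set ((Fin n → ℝ) × (Fin n → ℝ)) := {p | p.2 ∈ X ∧ dist p.2 p.1 ≤ N / 2}
  have hS : MeasurableSet S := (measurable_snd hX).inter
    (isClosed_le (continuous_snd.dist continuous_fst) continuous_const).measurableSet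
  have h1 := Measure.prod_apply (μ := (volume : Measure (Fin n → ℝ)))
    (ν := (volume : Measure (Fin n → ℝ))) hS
  rw [Measure.prod_apply_symm hS] at h1
  have h2 : ∀ z, Prod.mk z ⁻¹' S = X ∩ Metric.closedBall z (N / 2) := fun z => rfl
  -- Fubini: for fixed `x ∈ X` the admissible centres form a cube of volume `N^n`.
  have h3 : ∀ x, volume ((fun z => (z, x)) ⁻¹' S) =
      X.indicator (fun _ => ENNReal.ofReal N ^ n) x := fun x => by
    by_cases hx : x ∈ X
    · rw [Set.indicator_of_mem hx, ← volume_closedBall_half hN x]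
      congr 1
      ext z
      simp [S, hx, dist_comm]
    · simp [S, hx]
  simp only [h2, h3] at h1
  rw [← h1, lintegral_indicator_const hX]

/-- The averaged integrand vanishes at centres outside the `N/2`-thickening of `X`. -/
theorem volume_mul_le_mul_volume_add {X : Set (Fin n → ℝ)} (hX : IsCompact X) {N : ℝ}
    (hN : 0 ≤ N) {M : ENNReal} (hM : ∀ z, volume (X ∩ Metric.closedBall z (N / 2)) ≤ M) :
    ENNReal.ofReal N ^ n * volume X ≤ M * volume (X + Metric.closedBall 0 (N / 2)) := by
  have hm : MeasurableSet (X + Metric.closedBall 0 (N / 2)) :=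
    (hX.add (isCompact_closedBall _ _)).measurableSet
  rw [← lintegral_volume_inter_closedBall hX.measurableSet hN, ← lintegral_indicator_const hm]
  refine lintegral_mono fun z => ?_
  by_cases hz : z ∈ X + Metric.closedBall 0 (N / 2)
  · simpa [Set.indicator_of_mem hz] using hM z
  · have : X ∩ Metric.closedBall z (N / 2) = ∅ := by
      rw [Set.eq_empty_iff_forall_notMem]
      rintro x ⟨hx, hxz⟩
      refine hz ⟨x, hx, z - x, ?_, by simp⟩
      rw [Metric.mem_closedBall, dist_comm, dist_eq_norm] at hxz
      simpa using hxz
    simp [this]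

namespace IsSelfAffineTile

/-- Some cube contains at least the expected number of points of `D_∞`, up to a boundary term. -/
theorem le_mul_volume (hK : IsSelfAffineTile B D K) {r : ℝ}
    (hKr : K ⊆ Metric.closedBall 0 r) {N : ℝ} (hN : 0 ≤ N) {M : ENNReal}
    (hM : ∀ z, pointMasses (digitInfty B D) (Metric.closedBall z (N / 2 + r)) ≤ M) :
    ENNReal.ofReal N ^ n ≤ M * volume K := by
  have hdet := hK.det_ne_zero
  have hKc := hK.selfAffineSet.isCompact
  have hm0 : (D.card : ENNReal) ≠ 0 := by
    exact_mod_cast (Finset.card_pos.2 ⟨0, hK.pair.zero_mem⟩).ne'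
  have hcont : ∀ M : Matrix (Fin n) (Fin n) ℝ, Continuous M.mulVec := fun M =>
    continuous_const.matrix_mulVec continuous_id
  have hstep : ∀ s, ENNReal.ofReal N ^ n * volume K ≤ M * volume K *
      volume (K + (B⁻¹ ^ s).mulVec '' Metric.closedBall 0 (N / 2)) := fun s => by
    have h := volume_mul_le_mul_volume_add (hKc.image (hcont (B ^ s))) hN
      (M := M * volume K) fun z => by
        have hsub : (B ^ s).mulVec '' K ⊆ digitInfty B D + K := by
          rw [hK.selfAffineSet.image_pow_mulVec hdet]
          exact Set.add_subset_add_right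
            fun x hx => (mem_digitInfty hK.pair.zero_mem).2 ⟨s, hx⟩
        refine (measure_mono (Set.inter_subset_inter_left _ hsub)).trans ?_
        exact (volume_inter_le countable_digitInfty hKr _ _).trans
          (mul_le_mul_left (hM z) _)
    -- Pulling the estimate for `B^s K` back by `B^s` cancels `(card D)^s` and shrinks the boundary
    -- layer to `B⁻ˢ` of a ball, negligible as `s → ∞`.
    have hball : Metric.closedBall (0 : Fin n → ℝ) (N / 2) =
        (B ^ s).mulVec '' ((B⁻¹ ^ s).mulVec '' Metric.closedBall 0 (N / 2)) := by
      rw [← Set.image_comp]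
      convert (Set.image_id _).symm
      ext1 x
      rw [Function.comp_apply, Matrix.mulVec_mulVec, Matrix.inv_pow', Matrix.mul_nonsing_inv]
      · simp
      · simp [hdet]
    rw [hball, ← image_mulVec_add, hK.volume_image_pow, hK.volume_image_pow, mul_left_comm,
      mul_left_comm (M * volume K)] at h
    exact (ENNReal.mul_le_mul_iff_right (pow_ne_zero _ hm0)
      (ENNReal.pow_ne_top (ENNReal.natCast_ne_top _))).1 h
  have hlim : ENNReal.ofReal N ^ n * volume K ≤ M * volume K * volume K := by
    have ht : Tendsto (fun δ => M * volume K * volume (Metric.cthickening δ K)) (𝓝[>] 0)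
        (𝓝 (M * volume K * volume K)) :=
      ENNReal.Tendsto.const_mul
        ((tendsto_measure_cthickening_of_isCompact hKc).mono_left nhdsWithin_le_nhds)
        (Or.inl hK.volume_pos.ne')
    refine ge_of_tendsto ht ?_
    filter_upwards [self_mem_nhdsWithin] with δ hδ
    obtain ⟨s, hs⟩ := (hK.pair.expanding.eventually_norm_le hdet (N / 2) hδ).exists
    refine (hstep s).trans (mul_le_mul_right (measure_mono ?_) _)
    rintro _ ⟨k, hk, _, ⟨x, hx, rfl⟩, rfl⟩
    refine Metric.mem_cthickening_of_dist_le _ k _ _ hk ?_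
    simpa using hs x (by simpa using hx)
  exact (ENNReal.mul_le_mul_iff_left hK.volume_pos.ne' hK.volume_ne_top).1 hlim

end IsSelfAffineTile

/-! ### Values of the densities -/

theorem tendsto_ofReal_add_pow_div (c : ℝ) (a : ENNReal) :
    Tendsto (fun N : ℝ => ENNReal.ofReal (N + c) ^ n / ENNReal.ofReal N ^ n * a) atTop (𝓝 a) := by
  have h1 : Tendsto (fun N : ℝ => ENNReal.ofReal (1 + c / N) ^ n * a) atTop (𝓝 a) := by
    have h2 : Tendsto (fun N : ℝ => 1 + c / N) atTop (𝓝 (1 + 0)) :=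
      tendsto_const_nhds.add (tendsto_const_nhds.div_atTop tendsto_id)
    have h3 := ENNReal.Tendsto.mul_const (b := a)
      (ENNReal.Tendsto.pow (n := n) (ENNReal.tendsto_ofReal h2)) (Or.inl (by simp))
    simpa using h3
  refine h1.congr' ?_
  filter_upwards [eventually_gt_atTop 0] with N hN
  rw [div_eq_mul_inv (_ ^ n) (_ ^ n), ENNReal.inv_pow, ← mul_pow, ← div_eq_mul_inv,
    ← ENNReal.ofReal_div_of_pos hN, add_div, div_self hN.ne']

namespace IsSelfAffineTile

theorem tendsto_iSup (hK : IsSelfAffineTile B D K) :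
    Tendsto (fun N : ℝ => ⨆ z, pointMasses (digitInfty B D) (cube N z) / ENNReal.ofReal N ^ n)
      atTop (𝓝 (volume K)⁻¹) := by
  obtain ⟨r, hr, hKr⟩ := hK.selfAffineSet.isCompact.isBounded.subset_closedBall_lt 0 0
  refine tendsto_of_tendsto_of_tendsto_of_le_of_le'
    (tendsto_ofReal_add_pow_div (n := n) (-(2 * r)) _)
    (tendsto_ofReal_add_pow_div (n := n) (2 * r) _) ?_ ?_
  · filter_upwards [eventually_ge_atTop (2 * r)] with N hN
    have hN0 : 0 ≤ N := by linarith
    -- The shrunken side makes the counting radius `(N - 2r)/2 + r = N/2`.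
    have h := hK.le_mul_volume hKr (N := N - 2 * r) (by linarith)
      (M := ⨆ z, pointMasses (digitInfty B D) (cube N z)) fun z => by
        rw [sub_div, mul_div_cancel_left₀ _ two_ne_zero, sub_add_cancel, ← cube_eq_closedBall hN0]
        exact le_iSup (fun z => pointMasses (digitInfty B D) (cube N z)) z
    rw [← ENNReal.iSup_div, ← sub_eq_add_neg, mul_comm, ← mul_div_assoc, mul_comm, ← div_eq_mul_inv]
    gcongr
    exact ENNReal.div_le_of_le_mul h
  · filter_upwards [eventually_ge_atTop 0] with N hN
    refine iSup_le fun z => ?_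
    rw [cube_eq_closedBall hN, mul_comm, ← mul_div_assoc, mul_comm, ← div_eq_mul_inv]
    gcongr
    rw [ENNReal.le_div_iff_mul_le (Or.inl hK.volume_pos.ne') (Or.inl hK.volume_ne_top)]
    exact hK.pointMasses_mul_le hr.le hKr hN z

theorem upperDensity_eq (hK : IsSelfAffineTile B D K) :
    upperDensity (digitInfty B D) = (volume K)⁻¹ :=
  hK.tendsto_iSup.limsup_eq

theorem mem_image_pow (hK : IsSelfAffineTile B D K) (s : ℕ) (x : Fin n → ℝ) :
    x ∈ (B ^ s).mulVec '' K ↔ (B⁻¹ ^ s) *ᵥ x ∈ K := by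
  have hu : IsUnit (B ^ s).det := by simp [hK.det_ne_zero]
  constructor
  · rintro ⟨k, hk, rfl⟩
    rwa [Matrix.mulVec_mulVec, Matrix.inv_pow', Matrix.nonsing_inv_mul _ hu, Matrix.one_mulVec]
  · exact fun h => ⟨_, h, by
      rw [Matrix.mulVec_mulVec, Matrix.inv_pow', Matrix.mul_nonsing_inv _ hu, Matrix.one_mulVec]⟩

theorem digitInfty_add_eq_univ (hK : IsSelfAffineTile B D K) (h0 : K ∈ 𝓝 0) :
    digitInfty B D + K = Set.univ := by
  refine Set.eq_univ_of_forall fun x => ?_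
  obtain ⟨ε, hε, hball⟩ := Metric.nhds_basis_closedBall.mem_iff.1 h0
  obtain ⟨s, hs⟩ := (hK.pair.expanding.eventually_norm_le hK.det_ne_zero ‖x‖ hε).exists
  have hx : x ∈ (B ^ s).mulVec '' K :=
    (hK.mem_image_pow s x).2 (hball (by simpa using hs x le_rfl))
  rw [hK.selfAffineSet.image_pow_mulVec hK.det_ne_zero] at hx
  exact Set.add_subset_add_right
    (fun y hy => (mem_digitInfty hK.pair.zero_mem).2 ⟨s, hy⟩) hx

theorem lowerDensity_eq (hK : IsSelfAffineTile B D K) (h0 : K ∈ 𝓝 0) :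
    lowerDensity (digitInfty B D) = (volume K)⁻¹ := by
  obtain ⟨r, hr, hKr⟩ := hK.selfAffineSet.isCompact.isBounded.subset_closedBall_lt 0 0
  refine (tendsto_of_tendsto_of_tendsto_of_le_of_le'
    (tendsto_ofReal_add_pow_div (n := n) (-(2 * r)) _) hK.tendsto_iSup ?_
    (Eventually.of_forall fun N => iInf_le_iSup)).liminf_eq
  filter_upwards [eventually_ge_atTop (2 * r)] with N hN
  refine le_iInf fun z => ?_
  have h := volume_inter_le (countable_digitInfty (B := B) (D := D)) hKr ((N - 2 * r) / 2) z
  rw [hK.digitInfty_add_eq_univ h0, Set.univ_inter, volume_closedBall_half (by linarith),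
    sub_div, mul_div_cancel_left₀ _ two_ne_zero, sub_add_cancel,
    ← cube_eq_closedBall (by linarith)] at h
  rw [← sub_eq_add_neg, mul_comm, ← mul_div_assoc, mul_comm, ← div_eq_mul_inv]
  gcongr
  exact ENNReal.div_le_of_le_mul h

/-! ### Relative density of `D_∞` and neighborhoods of `0` -/

theorem inv_pow_mulVec_mem (hK : IsSelfAffineTile B D K) {s : ℕ} {x : Fin n → ℝ} (hx : x ∈ K) :
    (B⁻¹ ^ s) *ᵥ x ∈ K := by
  rw [← hK.mem_image_pow, hK.selfAffineSet.image_pow_mulVec hK.det_ne_zero]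
  exact ⟨0, zero_mem_digitExpansions hK.pair.zero_mem s, x, hx, zero_add x⟩

theorem zero_mem (hK : IsSelfAffineTile B D K) : (0 : Fin n → ℝ) ∈ K := by
  obtain ⟨x, hx⟩ := hK.selfAffineSet.nonempty
  have hlim : Tendsto (fun s : ℕ => (B⁻¹ ^ s) *ᵥ x) atTop (𝓝 0) := by
    refine Metric.tendsto_nhds.2 fun ε hε => ?_
    filter_upwards [hK.pair.expanding.eventually_norm_le hK.det_ne_zero ‖x‖ (half_pos hε)]
      with s hs
    rw [dist_zero_right]
    exact (hs x le_rfl).trans_lt (half_lt_self hε)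
  exact hK.selfAffineSet.isCompact.isClosed.mem_of_tendsto hlim
    (Eventually.of_forall fun s => hK.inv_pow_mulVec_mem hx)

/-- Scaling down by `B⁻¹ ^ s` maps `D_∞` into `D_∞ + K`. -/
theorem inv_pow_mulVec_digitInfty (hK : IsSelfAffineTile B D K) (s : ℕ) {x : Fin n → ℝ}
    (hx : x ∈ digitInfty B D) : (B⁻¹ ^ s) *ᵥ x ∈ digitInfty B D + K := by
  have h0 := hK.pair.zero_mem
  have hu : IsUnit (B ^ s).det := by simp [hK.det_ne_zero]
  obtain ⟨t, ht⟩ := (mem_digitInfty h0).1 hx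
  -- Lengthening the expansion to `s + t` digits lets the lowest `s` split off; `B⁻ˢ` sends that
  -- part into `K`.
  have ht' := digitExpansions_mono h0 (Nat.le_add_left t s) ht
  rw [digitExpansions_add] at ht'
  obtain ⟨d, hd, _, ⟨e, he, rfl⟩, rfl⟩ := ht'
  refine ⟨e, (mem_digitInfty h0).2 ⟨t, he⟩, (B⁻¹ ^ s) *ᵥ d, ?_, ?_⟩
  · rw [← hK.mem_image_pow, hK.selfAffineSet.image_pow_mulVec hK.det_ne_zero]
    exact ⟨d, hd, 0, hK.zero_mem, add_zero d⟩
  · rw [Matrix.mulVec_add, Matrix.mulVec_mulVec, Matrix.inv_pow', Matrix.nonsing_inv_mul _ hu,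
      Matrix.one_mulVec, add_comm]

/-- If `D_∞` is relatively dense, then the tile is a neighborhood of `0`. -/
theorem mem_nhds_zero_of_relativelyDense (hK : IsSelfAffineTile B D K) {ρ : ℝ}
    (h : ∀ z, (digitInfty B D ∩ Metric.closedBall z ρ).Nonempty) : K ∈ 𝓝 0 := by
  have hdet := hK.det_ne_zero
  have hKc := hK.selfAffineSet.isCompact
  obtain ⟨r, hr, hKr⟩ := hKc.isBounded.subset_closedBall_lt 0 0
  -- The radius adds `‖x‖ ≤ 1`, an approximation error at most 1, and `‖k‖ ≤ r`.
  set F := digitInfty B D ∩ Metric.closedBall 0 (2 + r) with hFdef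
  have hF : F.Finite := hK.finite_inter_closedBall _
  -- `F + K` is closed as `F` is finite, so approximating `x` by points of `B⁻ˢ D_∞` suffices.
  have hcover : Metric.closedBall (0 : Fin n → ℝ) 1 ⊆ F + K := by
    intro x hx
    rw [← (hF.isCompact.add hKc).isClosed.closure_eq, Metric.mem_closure_iff]
    intro ε hε
    obtain ⟨s, hs⟩ := (hK.pair.expanding.eventually_norm_le hdet ρ
      (lt_min (half_pos hε) one_pos)).exists
    have hu : IsUnit (B ^ s).det := by simp [hdet]
    obtain ⟨y, hy, hyx⟩ := h ((B ^ s) *ᵥ x)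
    have hdist : ‖(B⁻¹ ^ s) *ᵥ y - x‖ ≤ min (ε / 2) 1 := by
      have := hs _ (mem_closedBall_iff_norm.1 hyx)
      rwa [Matrix.mulVec_sub, Matrix.mulVec_mulVec, Matrix.inv_pow', Matrix.nonsing_inv_mul _ hu,
        Matrix.one_mulVec, ← Matrix.inv_pow'] at this
    obtain ⟨d, hd, k, hk, hdk⟩ := hK.inv_pow_mulVec_digitInfty s hy
    simp only at hdk
    refine ⟨_, ⟨d, ⟨hd, ?_⟩, k, hk, hdk⟩, ?_⟩
    · have hk' := mem_closedBall_zero_iff.1 (hKr hk)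
      have hx' := mem_closedBall_zero_iff.1 hx
      have hd' : d = ((B⁻¹ ^ s) *ᵥ y - x) + x - k := by rw [← hdk]; abel
      rw [mem_closedBall_zero_iff, hd']
      refine (norm_sub_le _ _).trans (add_le_add ((norm_add_le _ _).trans ?_) hk')
      linarith [hdist.trans (min_le_right _ _)]
    · rw [dist_comm, dist_eq_norm]
      exact (hdist.trans (min_le_left _ _)).trans_lt (half_lt_self hε)
  -- Finiteness puts `F` in one `D_s`, so the unit ball lies in `D_s + K = B^s K`; its preimage
  -- under `B^s` then lies in `K`.
  obtain ⟨s, hs⟩ := exists_subset_digitExpansions hK.pair.zero_mem hF Set.inter_subset_left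
  have hcont : Continuous (B ^ s).mulVec := continuous_const.matrix_mulVec continuous_id
  have hpre : (B ^ s).mulVec ⁻¹' Metric.closedBall 0 1 ∈ 𝓝 0 :=
    hcont.continuousAt.preimage_mem_nhds
      (by rw [Matrix.mulVec_zero]; exact Metric.closedBall_mem_nhds _ one_pos)
  refine mem_of_superset hpre fun x hx => ?_
  have hx' := Set.add_subset_add_right hs (hcover hx)
  rw [← hK.selfAffineSet.image_pow_mulVec hdet, hK.mem_image_pow, Matrix.mulVec_mulVec,
    Matrix.inv_pow', Matrix.nonsing_inv_mul _ (by simp [hdet]), Matrix.one_mulVec] at hx'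
  exact hx'

theorem lowerDensity_eq_zero (hK : IsSelfAffineTile B D K) (h0 : K ∉ 𝓝 0) :
    lowerDensity (digitInfty B D) = 0 := by
  have hzero : (fun N : ℝ =>
      ⨅ z, pointMasses (digitInfty B D) (cube N z) / ENNReal.ofReal N ^ n) =ᶠ[atTop]
        fun _ => 0 := by
    filter_upwards [eventually_gt_atTop 0] with N hN
    have hex : ∃ z, ¬(digitInfty B D ∩ Metric.closedBall z (N / 2)).Nonempty := by
      by_contra! hc
      exact h0 (hK.mem_nhds_zero_of_relativelyDense hc)
    obtain ⟨z, hz⟩ := hex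
    refine le_antisymm ((iInf_le _ z).trans ?_) zero_le
    rw [cube_eq_closedBall hN.le, pointMasses_apply _ Metric.isClosed_closedBall.measurableSet,
      Set.not_nonempty_iff_eq_empty.1 hz]
    simp
  exact (tendsto_const_nhds.congr' hzero.symm).liminf_eq

end IsSelfAffineTile
end SelfAffine

theorem mainTheorem3 {n : ℕ} (B : Matrix (Fin n) (Fin n) ℝ) (D : Finset (Fin n → ℝ))
    (K : Set (Fin n → ℝ)) (hK : SelfAffine.IsSelfAffineTile B D K) :
    (K ∈ 𝓝 (0 : Fin n → ℝ) ↔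
      SelfAffine.upperDensity (SelfAffine.digitInfty B D) = 1 / volume K ∧
        SelfAffine.lowerDensity (SelfAffine.digitInfty B D) = 1 / volume K) ∧
    (K ∉ 𝓝 (0 : Fin n → ℝ) ↔
      SelfAffine.upperDensity (SelfAffine.digitInfty B D) = 1 / volume K ∧
        SelfAffine.lowerDensity (SelfAffine.digitInfty B D) = 0) := by
  have hne : (volume K)⁻¹ ≠ 0 := ENNReal.inv_ne_zero.2 hK.volume_ne_top
  rw [one_div, hK.upperDensity_eq]
  by_cases h0 : K ∈ 𝓝 (0 : Fin n → ℝ)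
  · simp [h0, hK.lowerDensity_eq h0, hK.volume_ne_top]
  · simp [h0, hK.lowerDensity_eq_zero h0, hne.symm]
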